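/- **Conventions.** Let $n\in\{1,2,\dots\}\cup\{\infty\}$. An *open domain* is an open subset $H$ of some $\mathbb R^u$, $u\in\mathbb N$. *$\mathcal C^n$ spaces.* A $\mathcal C^n$ space $X$ is a set $|X|$ together with, for each open domain $H$, a set of maps $H\to|X|$ (the *figures* of type $H$), such that: figures are closed under precomposition with $\mathcal C^n$ maps of open domains; constant maps are figures; a map $H\to |X|$ whose restrictions to the members of some open cover of $H$ are figures is a figure. An arrow $X\to Y$ is a map $|X|\to|Y|$ taking figures to figures by composition. For $A\subseteq|X|$, $(A\prec X)$ has as figures the maps into $A$ that are figures of $X$. A set $U\subseteq |X|$ is open if $d^{-1}(U)$ is open for every figure $d$. A finite-dimensional normed space $E$ (in particular $\mathbb R^k$), or an open domain, is a $\mathcal C^n$ space with the ordinary $\mathcal C^n$ maps as figures. A *zone* $UK$ of $X$ is an open $U\subseteq|X|$ with an open domain $K$; an *observable* on $UK$ is an arrow $\varphi:(U\prec X)\to K$. *Extension.* A *nilpotent path* of $X$ is a map $x:\mathbb R\to|X|$, continuous at $0$, such that for every observable $\varphi$ on a zone $UK$ with $x_0\in U$ there is $k\in\mathbb N$ with $\|\varphi(x_t)-\varphi(x_0)\|^k=o(t)$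 as $t\to0$. Two nilpotent paths satisfy $x\sim y$ if for every observable $\varphi$ on a zone $UK$: $x_0\in U\iff y_0\in U$, and $x_0\in U$ implies $\varphi(x_t)=\varphi(y_t)+o(t)$. The set of classes is ${}^\bullet X$; an arrow $f$ induces ${}^\bullet f([x])=[f\circ x]$. Standard points are identified with classes of constant paths. For $U$ open in $X$, ${}^\bullet U:={}^\bullet(U\prec X)$ is regarded as a subset of ${}^\bullet X$ through the (injective) extension of the inclusion. In ${}^\bullet\mathbb R$ and ${}^\bullet\mathbb R^k$, sums and products by scalars in ${}^\bullet\mathbb R$ are computed on representatives. Put $D:=\{[h]\in{}^\bullet\mathbb R : h(t)=O(t)\text{ as }t\to0\}$. *Extended spaces.* Types of figures are now the subsets $T\subseteq{}^\bullet\mathbb R^{t}$, $t\in\mathbb N$, with the topology generated by the sets ${}^\bullet U\cap T$, $U\subseteq\mathbb R^t$ open. An arrow of types $f:S\to T$ (with $S\subseteq{}^\bullet\mathbb R^s$) is a map such that for every $s_0\in S$ there are an extended parameter $p\in{}^\bullet\mathbb R^m$ for some $m$, open sets $U\subseteq\mathbb R^m$, $V\subseteq\mathbb R^s$ with $p\in{}^\bullet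 U$, $s_0\in{}^\bullet V$, and a $\mathcal C^n$ map $g:U\times V\to\mathbb R^t$, with $f(x)={}^\bullet g\langle p,x\rangle$ for all $x\in{}^\bullet V\cap S$, where $\langle[p],[x]\rangle=[(p,x)]$. For $Z\subseteq{}^\bullet X$, the extended space ${}^\bullet(ZX)$ has support $Z$, and its figures $\delta:S\to Z$ are the maps that on a neighbourhood of every point of $S$ (open in $S$) are a composition $d\circ f$ of an arrow of types $f$ with a map $d:T\to Z$ that is constant or equal to ${}^\bullet h|_T$ for some figure $h:V\to|X|$ of $X$ with $T\subseteq{}^\bullet V$. The sets $D$ and ${}^\bullet X$ are considered as the extended spaces ${}^\bullet(D\,\mathbb R)$ and ${}^\bullet({}^\bullet X\,X)$. An arrow of extended spaces is a map taking figures to figures of the same type by composition. **Theorem.** Let $X$ be a $\mathcal C^n$ space, $\varphi$ an observable on a zone $U\,\mathbb R^k$ of $X$, and $f:D\to{}^\bullet X$ an arrow of extended spaces with $f(0)\in{}^\bullet U$. Then $f(h)\in{}^\bullet U$ for all $h\in D$, and there is one and only one pair $a\in{}^\bullet\mathbb R^k$, $b\in\mathbb R^k$ such that $${}^\bullet\varphi(f(h))=a+h\cdot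 b\qquad\text{for all }h\in D.$$ -/

import Mathlib

open Filter Topology Asymptotics

/-- The Euclidean space of dimension `k`. -/
abbrev Euc (k : ℕ) : Type := EuclideanSpace ℝ (Fin k)

/-- A function on a subset `A`, extended by `0`; only used at points of `A`, or at points near a
given point of an open `A`, where the value outside `A` is irrelevant. -/
noncomputable def zeroExt {S E : Type*} [Zero E] {A : Set S} (f : A → E) : S → E :=
  Function.extend Subtype.val f (fun _ => 0)

theorem zeroExt_of_mem {S E : Type*} [Zero E] {A : Set S} (f : A → E) {x : S} (hx : x ∈ A) :
    zeroExt f x = f ⟨x, hx⟩ :=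
  Subtype.val_injective.extend_apply f (fun _ => 0) ⟨x, hx⟩

/-! ### Open domains and `Cⁿ` maps between them -/

/-- The objects of the category of figure types: open subsets of some `ℝᵘ`, `u ∈ ℕ`. -/
structure OpenDomain where
  dim : ℕ
  carrier : Set (Euc dim)
  isOpen : IsOpen carrier

instance : CoeSort OpenDomain Type := ⟨fun H => H.carrier⟩

/-- `f : H → E` is an ordinary `Cⁿ` map on the open set `H`. -/
def IsCn (n : ℕ∞) {E : Type*} [NormedAddCommGroup E] [NormedSpace ℝ E] (H : OpenDomain)
    (f : H → E) : Prop :=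
  ContDiffOn ℝ n (zeroExt f) H.carrier

/-- `f : J → H` is an ordinary `Cⁿ` map between open sets. -/
def OpenDomain.Hom (n : ℕ∞) (J H : OpenDomain) (f : J → H) : Prop :=
  IsCn n J (fun x => (f x : Euc H.dim))

/-- The restriction of `H` to an open subset `V ⊆ H`. -/
def OpenDomain.restrict (H : OpenDomain) (V : Set (Euc H.dim)) (hV : IsOpen V) : OpenDomain :=
  ⟨H.dim, V, hV⟩

theorem IsCn.comp {n : ℕ∞} {E : Type*} [NormedAddCommGroup E] [NormedSpace ℝ E]
    {J H : OpenDomain} {f : J → H} {d : H → E} (hd : IsCn n H d) (hf : J.Hom n H f) :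
    IsCn n J (d ∘ f) := by
  have h := ContDiffOn.comp (s := J.carrier) hd hf (fun x hx => by
    rw [zeroExt_of_mem _ hx]; exact (f ⟨x, hx⟩).2)
  refine h.congr fun x hx => ?_
  rw [zeroExt_of_mem _ hx, Function.comp_apply, Function.comp_apply, zeroExt_of_mem _ hx,
    zeroExt_of_mem _ (f ⟨x, hx⟩).2]

theorem IsCn.const {n : ℕ∞} {E : Type*} [NormedAddCommGroup E] [NormedSpace ℝ E]
    (H : OpenDomain) (e : E) : IsCn n H (fun _ => e) :=
  (contDiffOn_const (c := e)).congr fun _ hx => zeroExt_of_mem _ hx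

theorem IsCn.sheaf {n : ℕ∞} {E : Type*} [NormedAddCommGroup E] [NormedSpace ℝ E]
    {H : OpenDomain} {d : H → E}
    (h : ∀ x : H, ∃ (V : Set (Euc H.dim)) (hV : IsOpen V) (hVH : V ⊆ H.carrier),
      (x : Euc H.dim) ∈ V ∧ IsCn n (H.restrict V hV) (fun v => d ⟨v.1, hVH v.2⟩)) :
    IsCn n H d := by
  intro x hx
  obtain ⟨V, hV, hVH, hxV, hd⟩ := h ⟨x, hx⟩
  have h1 : ContDiffOn ℝ n (zeroExt d) V := ContDiffOn.congr hd fun y hy => by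
    rw [zeroExt_of_mem _ (hVH hy)]
    exact (zeroExt_of_mem (A := V) (fun v => d ⟨v.1, hVH v.2⟩) hy).symm
  exact (h1.contDiffAt (hV.mem_nhds hxV)).contDiffWithinAt

theorem IsCn.continuous {n : ℕ∞} {E : Type*} [NormedAddCommGroup E] [NormedSpace ℝ E]
    {H : OpenDomain} {d : H → E} (hd : IsCn n H d) : Continuous d := by
  have h := (ContDiffOn.continuousOn hd).domRestrict
  convert h using 1
  funext x
  exact (zeroExt_of_mem d x.2).symm

/-! ### `Cⁿ` spaces -/

/-- A `Cⁿ` space with support set `S`: a family of figures `d : H → S`, for `H` an open domain,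
closed under `Cⁿ` reparametrization, containing the constant maps, and of local character. -/
structure CnSpace (n : ℕ∞) (S : Type*) where
  fig : ∀ H : OpenDomain, Set (H → S)
  comp_mem : ∀ {J H : OpenDomain} {f : J → H} {d : H → S},
    J.Hom n H f → d ∈ fig H → d ∘ f ∈ fig J
  const_mem : ∀ (H : OpenDomain) (s : S), (fun _ => s) ∈ fig H
  sheaf : ∀ {H : OpenDomain} {d : H → S},
    (∀ x : H, ∃ (V : Set (Euc H.dim)) (hV : IsOpen V) (hVH : V ⊆ H.carrier),
      (x : Euc H.dim) ∈ V ∧ (fun v => d ⟨v.1, hVH v.2⟩) ∈ fig (H.restrict V hV)) → d ∈ fig H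

namespace CnSpace

variable {n : ℕ∞} {S S' : Type*}

/-- `f` is an arrow of `Cⁿ` spaces: it takes figures to figures of the same type. -/
def IsArrow (X : CnSpace n S) (Y : CnSpace n S') (f : S → S') : Prop :=
  ∀ (H : OpenDomain), ∀ d ∈ X.fig H, f ∘ d ∈ Y.fig H

/-- The subspace `(A ≺ X)` induced by `X` on the subset `A`. -/
def sub (X : CnSpace n S) (A : Set S) : CnSpace n A where
  fig H := {d | (fun h => (d h : S)) ∈ X.fig H}
  comp_mem hf hd := X.comp_mem hf hd
  const_mem H s := X.const_mem H s
  sheaf h := X.sheaf h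

/-- The final topology with respect to all the figures. -/
@[reducible]
def topology (X : CnSpace n S) : TopologicalSpace S where
  IsOpen U := ∀ (H : OpenDomain), ∀ d ∈ X.fig H, IsOpen (d ⁻¹' U)
  isOpen_univ _ _ _ := isOpen_univ
  isOpen_inter _ _ hU hV H d hd := (hU H d hd).inter (hV H d hd)
  isOpen_sUnion _ h H d hd := by
    rw [Set.preimage_sUnion]
    exact isOpen_biUnion fun U hU => h U hU H d hd

/-- The `Cⁿ` space of a normed space `E`: its figures are the ordinary `Cⁿ` maps into `E`. -/
def std (n : ℕ∞) (E : Type*) [NormedAddCommGroup E] [NormedSpace ℝ E] : CnSpace n E where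
  fig H := {d | IsCn n H d}
  comp_mem hf hd := hd.comp hf
  const_mem H s := IsCn.const H s
  sheaf h := IsCn.sheaf h

/-- The `Cⁿ` space of an open domain `K`: its figures are the ordinary `Cⁿ` maps into `K`. -/
noncomputable def bar (n : ℕ∞) (K : OpenDomain) : CnSpace n K := (std n (Euc K.dim)).sub K.carrier

/-- `c` is an observable on the zone `UK` of `X`: `U` is open in `X`, `K` is an open domain and
`c : (U ≺ X) → K` is an arrow. -/
def IsObservable (X : CnSpace n S) (U : Set S) (K : OpenDomain) (c : U → K) : Prop :=
  IsOpen[X.topology] U ∧ (X.sub U).IsArrow (bar n K) c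

/-- The values of an observable, as vectors. -/
noncomputable def obs {U : Set S} {K : OpenDomain} (c : U → K) : S → Euc K.dim :=
  zeroExt fun u => (c u : Euc K.dim)

/-! ### Nilpotent paths and the extension of a `Cⁿ` space -/

/-- `x : ℝ → S` is continuous at the origin and nilpotent relative to `X`. -/
def IsNilpotentPath (X : CnSpace n S) (x : ℝ → S) : Prop :=
  @ContinuousAt ℝ S _ X.topology x 0 ∧
  ∀ (U : Set S) (K : OpenDomain) (c : U → K), X.IsObservable U K c → x 0 ∈ U →
    ∃ k : ℕ, (fun t => ‖obs c (x t) - obs c (x 0)‖ ^ k) =o[𝓝 0] (fun t : ℝ => t)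

/-- The relation `x ∼ y in X`. -/
def PathEquiv (X : CnSpace n S) (x y : ℝ → S) : Prop :=
  ∀ (U : Set S) (K : OpenDomain) (c : U → K), X.IsObservable U K c →
    (x 0 ∈ U ↔ y 0 ∈ U) ∧
    (x 0 ∈ U → (fun t => obs c (x t) - obs c (y t)) =o[𝓝 0] (fun t : ℝ => t))

/-- The set of nilpotent paths of `X`. -/
def NilpotentPath (X : CnSpace n S) : Type _ := {x : ℝ → S // X.IsNilpotentPath x}

instance pathSetoid (X : CnSpace n S) : Setoid X.NilpotentPath where
  r x y := X.PathEquiv x.1 y.1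
  iseqv :=
    { refl := fun x U K c _ => ⟨Iff.rfl, fun _ => by simp⟩
      symm := fun {x y} h U K c hc => ⟨(h U K c hc).1.symm, fun hy => by
        simpa using ((h U K c hc).2 ((h U K c hc).1.2 hy)).neg_left⟩
      trans := fun {x y z} h h' U K c hc =>
        ⟨(h U K c hc).1.trans (h' U K c hc).1, fun hx => by
          simpa using ((h U K c hc).2 hx).add ((h' U K c hc).2 ((h U K c hc).1.1 hx))⟩ }

/-- The (support set of the) extension of a `Cⁿ` space by infinitesimal points. -/
def Ext (X : CnSpace n S) : Type _ := Quotient X.pathSetoid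

/-- The extended point represented by a nilpotent path. -/
def Ext.mk (X : CnSpace n S) (x : ℝ → S) (hx : X.IsNilpotentPath x) : X.Ext :=
  Quotient.mk X.pathSetoid ⟨x, hx⟩

theorem Ext.mk_eq_mk {X : CnSpace n S} {x y : ℝ → S} {hx : X.IsNilpotentPath x}
    {hy : X.IsNilpotentPath y} : Ext.mk X x hx = Ext.mk X y hy ↔ X.PathEquiv x y :=
  Quotient.eq (r := X.pathSetoid)

theorem isNilpotentPath_const (X : CnSpace n S) (s : S) : X.IsNilpotentPath (fun _ => s) :=
  ⟨@continuousAt_const ℝ S _ X.topology 0 s, fun _ _ _ _ _ => ⟨1, by simp⟩⟩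

/-- The standard points, as classes of constant paths. -/
def Ext.const (X : CnSpace n S) (s : S) : X.Ext := Ext.mk X (fun _ => s) (X.isNilpotentPath_const s)

theorem IsArrow.continuous {X : CnSpace n S} {Y : CnSpace n S'} {f : S → S'}
    (hf : X.IsArrow Y f) : @Continuous S S' X.topology Y.topology f :=
  @Continuous.mk S S' X.topology Y.topology f fun _ hU H d hd => hU H (f ∘ d) (hf H d hd)

/-- Arrows pull observables back to observables. -/
theorem IsArrow.isObservable {X : CnSpace n S} {Y : CnSpace n S'} {f : S → S'}
    (hf : X.IsArrow Y f) {U : Set S'} {K : OpenDomain} {c : U → K} (hc : Y.IsObservable U K c) :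
    X.IsObservable (f ⁻¹' U) K (fun u => c ⟨f u.1, u.2⟩) :=
  ⟨fun H d hd => hc.1 H (f ∘ d) (hf H d hd),
    fun H d hd => hc.2 H (fun h => ⟨f (d h).1, (d h).2⟩) (hf H _ hd)⟩

theorem obs_preimage {f : S → S'} {U : Set S'} {K : OpenDomain} (c : U → K) (s : S) :
    obs (fun u : f ⁻¹' U => c ⟨f u.1, u.2⟩) s = obs c (f s) := by
  by_cases h : f s ∈ U
  · unfold obs
    rw [zeroExt_of_mem _ h, zeroExt_of_mem _ (show s ∈ f ⁻¹' U from h)]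
  · unfold obs zeroExt
    rw [Function.extend_apply', Function.extend_apply']
    · rintro ⟨a, ha⟩; exact h (ha ▸ a.2)
    · rintro ⟨a, ha⟩; exact h (show f s ∈ U from ha ▸ a.2)

theorem IsArrow.isNilpotentPath {X : CnSpace n S} {Y : CnSpace n S'} {f : S → S'}
    (hf : X.IsArrow Y f) {x : ℝ → S} (hx : X.IsNilpotentPath x) :
    Y.IsNilpotentPath (f ∘ x) := by
  refine ⟨?_, fun U K c hc h0 => ?_⟩
  · let := X.topology
    let := Y.topology
    exact (hf.continuous.continuousAt).comp hx.1
  · obtain ⟨k, hk⟩ := hx.2 _ K _ (hf.isObservable hc) h0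
    exact ⟨k, by simpa only [obs_preimage, Function.comp_apply] using hk⟩

theorem IsArrow.pathEquiv {X : CnSpace n S} {Y : CnSpace n S'} {f : S → S'}
    (hf : X.IsArrow Y f) {x y : ℝ → S} (h : X.PathEquiv x y) :
    Y.PathEquiv (f ∘ x) (f ∘ y) := by
  intro U K c hc
  have := h _ K _ (hf.isObservable hc)
  simpa only [obs_preimage, Function.comp_apply, Set.mem_preimage] using this

/-- The extension of an arrow: composition with representatives. -/
def Ext.map {X : CnSpace n S} {Y : CnSpace n S'} (f : S → S') (hf : X.IsArrow Y f) :
    X.Ext → Y.Ext :=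
  Quotient.map' (s₁ := X.pathSetoid) (s₂ := Y.pathSetoid)
    (fun x => ⟨f ∘ x.1, hf.isNilpotentPath x.2⟩) fun _ _ h => hf.pathEquiv h

theorem isArrow_val (X : CnSpace n S) (A : Set S) : (X.sub A).IsArrow X Subtype.val :=
  fun _ _ hd => hd

/-- The extension of `(A ≺ X)`, as a subset of the extension of `X` via the extended inclusion. -/
def dot (X : CnSpace n S) (A : Set S) : Set X.Ext :=
  Set.range (Ext.map Subtype.val (X.isArrow_val A))

/-- Open subsets of an open subspace are open in the space. -/
theorem isOpen_image_val {X : CnSpace n S} {A : Set S} (hA : IsOpen[X.topology] A) {W : Set A}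
    (hW : IsOpen[(X.sub A).topology] W) : IsOpen[X.topology] (Subtype.val '' W) := by
  intro H d hd
  have hV : IsOpen (Subtype.val '' (d ⁻¹' A) : Set (Euc H.dim)) :=
    H.isOpen.isOpenMap_subtype_val _ (hA H d hd)
  have hsub : (Subtype.val '' (d ⁻¹' A) : Set (Euc H.dim)) ⊆ H.carrier := by
    rintro _ ⟨y, -, rfl⟩; exact y.2
  let J := H.restrict _ hV
  let i : J → H := fun v => ⟨v.1, hsub v.2⟩
  have hi : J.Hom n H i := (contDiffOn_id (n := n)).congr fun x hx => zeroExt_of_mem _ hx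
  have hmem : ∀ v : J, d (i v) ∈ A := by
    rintro ⟨_, y, hy, rfl⟩; exact hy
  have ho := hW J (fun v => ⟨d (i v), hmem v⟩) (X.comp_mem hi hd)
  have hio : IsOpenMap i := fun O hO => by
    have h1 := hV.isOpenMap_subtype_val _ hO
    have h2 := h1.preimage (continuous_subtype_val (p := fun x => x ∈ H.carrier))
    convert h2 using 1
    ext y
    constructor
    · rintro ⟨v, hv, rfl⟩; exact ⟨v, hv, rfl⟩
    · rintro ⟨v, hv, hvy⟩; exact ⟨v, hv, Subtype.ext hvy⟩
  convert hio _ ho using 1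
  ext y
  constructor
  · rintro ⟨w, hw, hwy⟩
    have hy : d y ∈ A := hwy ▸ w.2
    refine ⟨⟨y.1, y, hy, rfl⟩, ?_, rfl⟩
    have : w = ⟨d y, hy⟩ := Subtype.ext hwy
    subst this; exact hw
  · rintro ⟨v, hv, rfl⟩
    exact ⟨_, hv, rfl⟩

/-- The extension of an open subspace is a subset of the extension of the space. -/
theorem Ext.map_val_injective {X : CnSpace n S} {A : Set S} (hA : IsOpen[X.topology] A) :
    Function.Injective (Ext.map Subtype.val (X.isArrow_val A)) := by
  rintro ⟨x, hx⟩ ⟨y, hy⟩ h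
  refine Ext.mk_eq_mk.2 fun W K c hc => ?_
  have h' : X.PathEquiv (Subtype.val ∘ x) (Subtype.val ∘ y) := Ext.mk_eq_mk.1 h
  let g : (Subtype.val '' W : Set S) → W := fun s => ⟨⟨s.1, by
    obtain ⟨w, -, hw⟩ := s.2; exact hw ▸ w.2⟩, by
    obtain ⟨w, hw, hws⟩ := s.2
    have e : (⟨s.1, hws ▸ w.2⟩ : A) = w := Subtype.ext hws.symm
    rw [e]; exact hw⟩
  have key := h' (Subtype.val '' W) K (fun s => c (g s))
    ⟨isOpen_image_val hA hc.1, fun H d hd => hc.2 H (fun v => g (d v)) hd⟩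
  have hm : ∀ a : A, (a : S) ∈ (Subtype.val '' W : Set S) ↔ a ∈ W := fun a =>
    Subtype.val_injective.mem_set_image
  have ho : ∀ a : A, obs (fun s => c (g s)) (a : S) = obs c a := fun a => by
    by_cases ha : a ∈ W
    · unfold obs
      rw [zeroExt_of_mem _ ha, zeroExt_of_mem _ ((hm a).2 ha)]
    · unfold obs zeroExt
      rw [Function.extend_apply', Function.extend_apply']
      · rintro ⟨b, hb⟩; exact ha (hb ▸ b.2)
      · rintro ⟨b, hb⟩; exact ha ((hm a).1 (hb ▸ b.2))
  simpa only [Function.comp_apply, hm, ho] using key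

/-- The value of the extension of `f : (A ≺ X) → Y` at a point of the extension of `(A ≺ X)`, the
latter seen as a subset of the extension of `X`. -/
noncomputable def Ext.mapOn {X : CnSpace n S} {Y : CnSpace n S'} {A : Set S} (f : A → S')
    (hf : (X.sub A).IsArrow Y f) (z : X.dot A) : Y.Ext :=
  Ext.map f hf z.2.choose

theorem Ext.mapOn_map {X : CnSpace n S} {Y : CnSpace n S'} {A : Set S}
    (hA : IsOpen[X.topology] A) (f : A → S') (hf : (X.sub A).IsArrow Y f) (u : (X.sub A).Ext) :
    Ext.mapOn f hf ⟨Ext.map Subtype.val (X.isArrow_val A) u, u, rfl⟩ = Ext.map f hf u := by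
  unfold Ext.mapOn
  congr 1
  exact Ext.map_val_injective hA (Exists.choose_spec (p := fun v =>
    Ext.map Subtype.val (X.isArrow_val A) v = Ext.map Subtype.val (X.isArrow_val A) u) ⟨u, rfl⟩)

/-! ### The extended real field `·ℝ` and the `·ℝ`-module `·ℝᵏ` -/

section Std

variable {E F : Type*} [NormedAddCommGroup E]

theorem tendsto_of_isLittleO {x : ℝ → E} {k : ℕ}
    (h : (fun t => ‖x t - x 0‖ ^ k) =o[𝓝 0] (fun t : ℝ => t)) :
    Tendsto x (𝓝 0) (𝓝 (x 0)) := by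
  have h0 : Tendsto (fun t => ‖x t - x 0‖ ^ k) (𝓝 0) (𝓝 0) := h.trans_tendsto tendsto_id
  have hk : k ≠ 0 := by
    rintro rfl
    simp at h0
  rw [tendsto_iff_norm_sub_tendsto_zero]
  refine tendsto_order.2 ⟨fun a ha => Eventually.of_forall fun t => ha.trans_le (norm_nonneg _),
    fun a ha => ?_⟩
  filter_upwards [h0.eventually (gt_mem_nhds (pow_pos ha k))] with t ht
  exact lt_of_pow_lt_pow_left₀ k ha.le ht

variable [NormedSpace ℝ E] [NormedAddCommGroup F] [NormedSpace ℝ F]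

/-- A `Cⁿ` map on a subset of `E` is an arrow. -/
theorem isArrow_of_contDiffOn {A : Set E} {g : A → F} (hg : ContDiffOn ℝ n (zeroExt g) A) :
    ((std n E).sub A).IsArrow (std n F) g := by
  intro H d hd
  have h := ContDiffOn.comp (s := H.carrier) hg hd (fun x hx => by
    rw [zeroExt_of_mem _ hx]; exact (d ⟨x, hx⟩).2)
  refine h.congr fun x hx => ?_
  rw [zeroExt_of_mem _ hx, Function.comp_apply, Function.comp_apply, zeroExt_of_mem _ hx,
    zeroExt_of_mem _ (d ⟨x, hx⟩).2]

theorem isArrow_of_contDiff {g : E → F} (hg : ContDiff ℝ n g) :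
    (std n E).IsArrow (std n F) g := by
  intro H d hd
  refine (hg.comp_contDiffOn hd).congr fun x hx => ?_
  rw [zeroExt_of_mem _ hx]
  exact congrArg g (zeroExt_of_mem d hx).symm

variable [FiniteDimensional ℝ E] [FiniteDimensional ℝ F]

/-- The chart of the open set `U` of `E` given by linear coordinates. -/
noncomputable abbrev chartDomain (U : Set E) (hU : IsOpen U) : OpenDomain :=
  ⟨Module.finrank ℝ E, (toEuclidean (E := E)).symm ⁻¹' U,
    hU.preimage (toEuclidean (E := E)).symm.continuous⟩

theorem chart_mem_fig (U : Set E) (hU : IsOpen U) :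
    (fun v : chartDomain U hU => (toEuclidean (E := E)).symm v.1) ∈ (std n E).fig _ :=
  ((toEuclidean (E := E)).symm.contDiff.contDiffOn).congr fun _ hx => zeroExt_of_mem _ hx

theorem isOpen_std {U : Set E} : IsOpen[(std n E).topology] U ↔ IsOpen U := by
  constructor
  · intro h
    have h1 := h _ _ (chart_mem_fig (n := n) Set.univ isOpen_univ)
    have h2 := (chartDomain (Set.univ : Set E) isOpen_univ).isOpen.isOpenMap_subtype_val _ h1
    convert h2.preimage (toEuclidean (E := E)).continuous using 1
    ext x
    constructor
    · intro hx
      exact ⟨⟨toEuclidean x, trivial⟩,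
        show (toEuclidean (E := E)).symm (toEuclidean x) ∈ U by simpa using hx, rfl⟩
    · rintro ⟨v, hv, hvx⟩
      have h3 : (toEuclidean (E := E)).symm v.1 ∈ U := hv
      rwa [hvx, ContinuousLinearEquiv.symm_apply_apply] at h3
  · intro h H d hd
    exact h.preimage (IsCn.continuous hd)

theorem topology_std : (std n E).topology = (inferInstance : TopologicalSpace E) :=
  TopologicalSpace.ext_iff.2 fun _ => isOpen_std

/-- Observables on `E` are ordinary `Cⁿ` maps. -/
theorem IsObservable.contDiffOn {U : Set E} {K : OpenDomain} {c : U → K}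
    (hc : (std n E).IsObservable U K c) : ContDiffOn ℝ n (obs c) U := by
  have hU := isOpen_std.1 hc.1
  have h := hc.2 (chartDomain U hU) (fun v => ⟨(toEuclidean (E := E)).symm v.1, v.2⟩)
    (chart_mem_fig U hU)
  have h' := ContDiffOn.comp (s := U) h (toEuclidean (E := E)).contDiff.contDiffOn
    (fun x hx => show (toEuclidean (E := E)).symm (toEuclidean x) ∈ U by simpa using hx)
  refine h'.congr fun x hx => ?_
  have hx' : (toEuclidean (E := E)).symm (toEuclidean x) ∈ U := by simpa using hx
  have e1 : obs c x = c ⟨x, hx⟩ := zeroExt_of_mem _ hx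
  have e2 := zeroExt_of_mem (fun v : chartDomain U hU =>
    (c ⟨(toEuclidean (E := E)).symm v.1, v.2⟩ : Euc K.dim)) (x := toEuclidean x) hx'
  refine e1.trans (Eq.trans ?_ e2.symm)
  simp

theorem isObservable_chart :
    (std n E).IsObservable Set.univ (chartDomain (Set.univ : Set E) isOpen_univ)
      (fun u => ⟨toEuclidean u.1, trivial⟩) := by
  refine ⟨isOpen_std.2 isOpen_univ, fun H d hd => ?_⟩
  refine ((toEuclidean (E := E)).contDiff.comp_contDiffOn (s := H.carrier) hd).congr
    fun x hx => ?_
  refine (zeroExt_of_mem _ hx).trans ?_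
  exact congrArg (toEuclidean (E := E)) (zeroExt_of_mem (fun h => (d h : E)) hx).symm

theorem obs_chart (x : E) :
    obs (K := chartDomain (Set.univ : Set E) isOpen_univ)
      (fun u : (Set.univ : Set E) => ⟨toEuclidean u.1, trivial⟩) x = toEuclidean x :=
  zeroExt_of_mem _ (Set.mem_univ x)

theorem norm_isBigO_chart (u v : ℝ → E) :
    (fun t => u t - v t) =O[𝓝 0] (fun t => toEuclidean (u t) - toEuclidean (v t)) := by
  have := ((toEuclidean (E := E)).symm : _ →L[ℝ] E).isBigO_comp
    (fun t => toEuclidean (u t) - toEuclidean (v t)) (𝓝 (0 : ℝ))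
  simpa using this

theorem IsObservable.isBigO [hn : Fact (1 ≤ n)] {U : Set E} {K : OpenDomain} {c : U → K}
    (hc : (std n E).IsObservable U K c) {u v : ℝ → E} {e : E} (he : e ∈ U)
    (hu : Tendsto u (𝓝 0) (𝓝 e)) (hv : Tendsto v (𝓝 0) (𝓝 e)) :
    (fun t => obs c (u t) - obs c (v t)) =O[𝓝 0] (fun t => u t - v t) := by
  have h1 : ContDiffAt ℝ 1 (obs c) e :=
    (hc.contDiffOn.contDiffAt ((isOpen_std.1 hc.1).mem_nhds he)).of_le (by exact_mod_cast hn.out)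
  obtain ⟨C, s, hs, hC⟩ := h1.exists_lipschitzOnWith
  refine IsBigO.of_bound C ?_
  filter_upwards [hu hs, hv hs] with t hut hvt
  simpa [dist_eq_norm] using hC.dist_le_mul _ hut _ hvt

/-- Nilpotency in a normed space is nilpotency in the elementary sense. -/
theorem isNilpotentPath_std [Fact (1 ≤ n)] {x : ℝ → E} :
    (std n E).IsNilpotentPath x ↔
      ∃ k : ℕ, (fun t => ‖x t - x 0‖ ^ k) =o[𝓝 0] (fun t : ℝ => t) := by
  constructor
  · intro h
    obtain ⟨k, hk⟩ := h.2 _ _ _ isObservable_chart (Set.mem_univ _)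
    refine ⟨k, IsBigO.trans_isLittleO ?_ hk⟩
    simp only [obs_chart]
    exact ((norm_isBigO_chart x fun _ => x 0).norm_norm).pow k
  · rintro ⟨k, hk⟩
    have hx := tendsto_of_isLittleO hk
    refine ⟨by rw [topology_std]; exact hx, fun U K c hc h0 => ⟨k, IsBigO.trans_isLittleO ?_ hk⟩⟩
    exact ((hc.isBigO h0 hx tendsto_const_nhds).norm_norm).pow k

theorem IsNilpotentPath.tendsto {x : ℝ → E} (hx : (std n E).IsNilpotentPath x) :
    Tendsto x (𝓝 0) (𝓝 (x 0)) := by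
  have := hx.1
  rw [topology_std] at this
  exact this

/-- In a normed space `x ∼ y` means `x(t) = y(t) + o(t)`. -/
theorem pathEquiv_std [Fact (1 ≤ n)] {x y : ℝ → E} (hx : (std n E).IsNilpotentPath x)
    (hy : (std n E).IsNilpotentPath y) :
    (std n E).PathEquiv x y ↔ (fun t => x t - y t) =o[𝓝 0] (fun t : ℝ => t) := by
  constructor
  · intro h
    have := (h _ _ _ isObservable_chart).2 (Set.mem_univ _)
    simp only [obs_chart] at this
    exact (norm_isBigO_chart x y).trans_isLittleO this
  · intro h U K c hc
    have h0 : x 0 = y 0 := by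
      have h1 : Tendsto (fun t => x t - y t) (𝓝 0) (𝓝 0) := h.trans_tendsto tendsto_id
      exact sub_eq_zero.1 (tendsto_nhds_unique (hx.tendsto.sub hy.tendsto) h1)
    exact ⟨by rw [h0], fun hU => (hc.isBigO hU hx.tendsto (h0 ▸ hy.tendsto)).trans_isLittleO h⟩

theorem isNilpotentPath_pair [Fact (1 ≤ n)] {x : ℝ → E} {y : ℝ → F}
    (hx : (std n E).IsNilpotentPath x) (hy : (std n F).IsNilpotentPath y) :
    (std n (E × F)).IsNilpotentPath (fun t => (x t, y t)) := by
  obtain ⟨k, hk⟩ := isNilpotentPath_std.1 hx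
  obtain ⟨l, hl⟩ := isNilpotentPath_std.1 hy
  refine isNilpotentPath_std.2 ⟨k + l, ?_⟩
  have hx0 : Tendsto (fun t => ‖x t - x 0‖) (𝓝 0) (𝓝 0) :=
    tendsto_iff_norm_sub_tendsto_zero.1 hx.tendsto
  have hy0 : Tendsto (fun t => ‖y t - y 0‖) (𝓝 0) (𝓝 0) :=
    tendsto_iff_norm_sub_tendsto_zero.1 hy.tendsto
  refine IsBigO.trans_isLittleO (IsBigO.of_bound 1 ?_) (hk.norm_left.add hl.norm_left)
  filter_upwards [hx0.eventually (ge_mem_nhds one_pos), hy0.eventually (ge_mem_nhds one_pos)]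
    with t h1 h2
  have a0 := norm_nonneg (x t - x 0)
  have b0 := norm_nonneg (y t - y 0)
  have e1 : ‖((x t, y t) : E × F) - (x 0, y 0)‖ = max ‖x t - x 0‖ ‖y t - y 0‖ := rfl
  rw [e1, Real.norm_of_nonneg (by positivity), Real.norm_of_nonneg (by positivity),
    Real.norm_of_nonneg (by positivity), Real.norm_of_nonneg (by positivity), one_mul]
  rcases max_choice ‖x t - x 0‖ ‖y t - y 0‖ with h | h <;> rw [h]
  · exact (pow_le_pow_of_le_one a0 h1 (Nat.le_add_right k l)).trans
      (le_add_of_nonneg_right (by positivity))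
  · exact (pow_le_pow_of_le_one b0 h2 (Nat.le_add_left l k)).trans
      (le_add_of_nonneg_left (by positivity))

/-- The pairing `⟨p, x⟩` of two extended points: pairing of representatives. -/
noncomputable def Ext.pair [Fact (1 ≤ n)] : (std n E).Ext → (std n F).Ext → (std n (E × F)).Ext :=
  Quotient.map₂ (sa := (std n E).pathSetoid) (sb := (std n F).pathSetoid)
    (sc := (std n (E × F)).pathSetoid)
    (fun x y => ⟨fun t => (x.1 t, y.1 t), isNilpotentPath_pair x.2 y.2⟩)
    fun x x' hx y y' hy => by
      refine (pathEquiv_std (isNilpotentPath_pair x.2 y.2) (isNilpotentPath_pair x'.2 y'.2)).2 ?_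
      exact ((pathEquiv_std x.2 x'.2).1 hx).prod_left ((pathEquiv_std y.2 y'.2).1 hy)

/-- Sum of representatives. -/
noncomputable instance [Fact (1 ≤ n)] : Add (std n E).Ext where
  add a b := Ext.map (fun q : E × E => q.1 + q.2) (isArrow_of_contDiff contDiff_add)
    (Ext.pair a b)

/-- Product of representatives. -/
noncomputable instance [Fact (1 ≤ n)] : SMul (std n ℝ).Ext (std n E).Ext where
  smul h a := Ext.map (fun q : ℝ × E => q.1 • q.2) (isArrow_of_contDiff contDiff_smul)
    (Ext.pair h a)

end Std

/-- The set `D ⊆ ·ℝ` of first order infinitesimals: those represented by an `x` with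
`x(t) = O(t)`. -/
def infinitesimals (n : ℕ∞) : Set (std n ℝ).Ext :=
  {h | ∃ (x : ℝ → ℝ) (hx : (std n ℝ).IsNilpotentPath x),
    h = Ext.mk (std n ℝ) x hx ∧ x =O[𝓝 0] (fun t : ℝ => t)}

theorem zero_mem_infinitesimals (n : ℕ∞) : Ext.const (std n ℝ) 0 ∈ infinitesimals n :=
  ⟨fun _ => 0, (std n ℝ).isNilpotentPath_const 0, rfl, isBigO_zero _ _⟩

end CnSpace

/-! ### The category of extended spaces -/

open CnSpace

/-- The objects of the category of types of figures for extended spaces: arbitrary subsets of some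
`·ℝˢ`. -/
structure ExtDomain (n : ℕ∞) where
  dim : ℕ
  carrier : Set (std n (Euc dim)).Ext

namespace ExtDomain

variable {n : ℕ∞}

instance : CoeSort (ExtDomain n) Type := ⟨fun T => T.carrier⟩

/-- The topology generated by the sets `·U ∩ T`, for `U` open in the Euclidean space. -/
instance (T : ExtDomain n) : TopologicalSpace T :=
  TopologicalSpace.generateFrom
    {O | ∃ U : Set (Euc T.dim), IsOpen U ∧ O = {x : T | x.1 ∈ (std n (Euc T.dim)).dot U}}

/-- Arrows: maps that locally are of the form `x ↦ ·g⟨p, x⟩`, for an extended parameter `p` and an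
ordinary `Cⁿ` map `g : U × V → ℝᵗ`. -/
def Hom [Fact (1 ≤ n)] (S T : ExtDomain n) (f : S → T) : Prop :=
  ∀ s : S, ∃ (m : ℕ) (p : (std n (Euc m)).Ext) (U : Set (Euc m)) (V : Set (Euc S.dim))
    (g : U ×ˢ V → Euc T.dim) (hg : ContDiffOn ℝ n (zeroExt g) (U ×ˢ V)),
    IsOpen U ∧ p ∈ (std n (Euc m)).dot U ∧
    IsOpen V ∧ s.1 ∈ (std n (Euc S.dim)).dot V ∧
    ∀ x : S, x.1 ∈ (std n (Euc S.dim)).dot V →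
      ∃ hx : Ext.pair p x.1 ∈ (std n (Euc m × Euc S.dim)).dot (U ×ˢ V),
        (f x).1 = Ext.mapOn g (isArrow_of_contDiffOn hg) ⟨Ext.pair p x.1, hx⟩

/-- The restriction of `S` to an open subset. -/
def restrict (S : ExtDomain n) (O : Set S) : ExtDomain n := ⟨S.dim, Subtype.val '' O⟩

end ExtDomain

/-- A family of figures on the set `A`, one set of figures for every type. -/
abbrev ExtFigures (n : ℕ∞) (A : Type*) := ∀ T : ExtDomain n, Set (T → A)

/-- The arrows of extended spaces take figures to figures of the same type. -/
def ExtFigures.IsArrow {n : ℕ∞} {A B : Type*} (P : ExtFigures n A) (Q : ExtFigures n B)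
    (f : A → B) : Prop :=
  ∀ T : ExtDomain n, ∀ d ∈ P T, f ∘ d ∈ Q T

/-- The figures generated by a given family: those that locally are a composition of an arrow with
a figure of the family. -/
def ExtFigures.generate {n : ℕ∞} [Fact (1 ≤ n)] {A : Type*} (P : ExtFigures n A) :
    ExtFigures n A :=
  fun S => {δ | ∀ s : S, ∃ (O : Set S) (T : ExtDomain n) (d : T → A) (f : S.restrict O → T),
    IsOpen O ∧ s ∈ O ∧ d ∈ P T ∧ (S.restrict O).Hom T f ∧
    ∀ (x : S) (hx : x ∈ O), δ x = d (f ⟨x.1, x, hx, rfl⟩)}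

namespace CnSpace

variable {n : ℕ∞} {S : Type*}

/-- A figure of `X` is an arrow from its domain. -/
theorem isArrow_of_mem_fig (X : CnSpace n S) {H : OpenDomain} {h : H → S} (hh : h ∈ X.fig H) :
    ((std n (Euc H.dim)).sub H.carrier).IsArrow X h :=
  fun _ _ hd => X.comp_mem hd hh

/-- The generating figures on a subset `Z` of the extension of `X`: the constant maps, and the maps
`·h|_T`, where `h : V → X` is a figure of `X` with `T ⊆ ·V`. -/
def generatingFigures (X : CnSpace n S) (Z : Set X.Ext) : ExtFigures n Z :=
  fun T => {d | (∃ z : Z, d = fun _ => z) ∨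
    ∃ (V : Set (Euc T.dim)) (hV : IsOpen V) (h : V → S) (hh : h ∈ X.fig ⟨T.dim, V, hV⟩)
      (hT : T.carrier ⊆ (std n (Euc T.dim)).dot V),
      ∀ x : T, (d x).1 = Ext.mapOn h (X.isArrow_of_mem_fig hh) ⟨x.1, hT x.2⟩}

/-- The figures of the extended space induced by `X` on a subset `Z` of its extension. -/
def inducedFigures [Fact (1 ≤ n)] (X : CnSpace n S) (Z : Set X.Ext) : ExtFigures n Z :=
  (X.generatingFigures Z).generate

/-- The figures of the extended space `·X`, which is the one induced by `X` on all of `·X`. -/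
def extFigures [Fact (1 ≤ n)] (X : CnSpace n S) : ExtFigures n X.Ext :=
  fun T => {d | (fun x => (⟨d x, trivial⟩ : (Set.univ : Set X.Ext))) ∈
    X.inducedFigures Set.univ T}

end CnSpace

/-! All elements of `D` have standard part 0, so any subset of some `·V` that meets `D` contains the
whole of `D`: the topology of `D` is indiscrete, and local descriptions over `D` are global. Applied
to the generic figure of `D` (its coordinate, `infinitesimalCoord_mem_figures`), an arrow `f : D →
·X` is therefore either constant or of the form `·h(·G⟨p, x⟩)` on all of `D`, with a single figure
`h` of `X`, a single `Cⁿ` map `G` and a single extended parameter `p` (`constant_or_exists_figure`).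
In particular the standard part of `f(x)` does not depend on `x`, so membership in `·U` is decided
at 0.

Put `Ψ = φ ∘ h ∘ G`, a `Cⁿ` map near `(p₀, 0)`. As `n ≥ 1`, it is strictly differentiable there, so
`Ψ(p_t, x_t) - Ψ(p_t, 0) = x_t • b + o(x_t)`, where `b` is the partial derivative at the standard
point `(p₀, 0)`. The error is `o(t)` because `x_t = O(t)`, and `a` is the class of `Ψ(p_t, 0)`.
Strictness is essential: `p_t - p₀` is nilpotent but need not be `O(t)`, so an expansion around the
fixed point `(p₀, 0)` would leave too large an error.

Uniqueness (`Ext.affine_injective`) follows from the values at the classes of `0` and of `t ↦ t`. -/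

namespace CnSpace

/-! ### Germs of paths, open subspaces and representatives -/

section General

variable {n : ℕ∞} {S S' : Type*} {X : CnSpace n S} {Y : CnSpace n S'}

theorem IsNilpotentPath.congr {x y : ℝ → S} (hx : X.IsNilpotentPath x) (h : x =ᶠ[𝓝 0] y) :
    X.IsNilpotentPath y := by
  have h0 : x 0 = y 0 := h.self_of_nhds
  refine ⟨?_, fun U K c hc hU => ?_⟩
  · let := X.topology
    exact ContinuousAt.congr hx.1 h
  · obtain ⟨k, hk⟩ := hx.2 U K c hc (h0 ▸ hU)
    refine ⟨k, hk.congr' ?_ EventuallyEq.rfl⟩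
    filter_upwards [h] with t ht
    rw [ht, h0]

theorem PathEquiv.of_eventuallyEq {x y : ℝ → S} (h : x =ᶠ[𝓝 0] y) : X.PathEquiv x y := by
  have h0 : x 0 = y 0 := h.self_of_nhds
  refine fun U K c _ => ⟨by rw [h0], fun _ => ?_⟩
  refine (isLittleO_zero _ _).congr' ?_ EventuallyEq.rfl
  filter_upwards [h] with t ht
  rw [ht, sub_self]

theorem Ext.exists_rep (z : X.Ext) : ∃ (x : ℝ → S) (hx : X.IsNilpotentPath x),
    z = Ext.mk X x hx := by
  obtain ⟨⟨x, hx⟩, rfl⟩ := Quotient.exists_rep z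
  exact ⟨x, hx, rfl⟩

/-- Observables of an open subspace are observables of the space. -/
theorem IsObservable.exists_of_sub {A : Set S} (hA : IsOpen[X.topology] A) {W : Set A}
    {K : OpenDomain} {c : W → K} (hc : (X.sub A).IsObservable W K c) :
    ∃ c' : (Subtype.val '' W : Set S) → K, X.IsObservable (Subtype.val '' W) K c' ∧
      ∀ a : A, obs c' (a : S) = obs c a := by
  let g : (Subtype.val '' W : Set S) → W := fun s => ⟨⟨s.1, by
    obtain ⟨w, -, hw⟩ := s.2; exact hw ▸ w.2⟩, by
    obtain ⟨w, hw, hws⟩ := s.2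
    have e : (⟨s.1, hws ▸ w.2⟩ : A) = w := Subtype.ext hws.symm
    rw [e]; exact hw⟩
  have hm : ∀ a : A, (a : S) ∈ (Subtype.val '' W : Set S) ↔ a ∈ W := fun a =>
    Subtype.val_injective.mem_set_image
  refine ⟨fun s => c (g s),
    ⟨isOpen_image_val hA hc.1, fun H d hd => hc.2 H (fun v => g (d v)) hd⟩, fun a => ?_⟩
  by_cases ha : a ∈ W
  · unfold obs
    rw [zeroExt_of_mem _ ha, zeroExt_of_mem _ ((hm a).2 ha)]
  · unfold obs zeroExt
    rw [Function.extend_apply', Function.extend_apply']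
    · rintro ⟨b, hb⟩; exact ha (hb ▸ b.2)
    · rintro ⟨b, hb⟩; exact ha ((hm a).1 (hb ▸ b.2))

/-- Open sets and observables of `(A ≺ X)` are also open sets and observables of `X` when `A` is
open, so both defining conditions can be tested in `X`. -/
theorem IsNilpotentPath.of_val {A : Set S} (hA : IsOpen[X.topology] A) {x : ℝ → A}
    (hx : X.IsNilpotentPath (Subtype.val ∘ x)) : (X.sub A).IsNilpotentPath x := by
  refine ⟨?_, fun W K c hc h0 => ?_⟩
  · let := X.topology
    let := (X.sub A).topology
    refine fun s hs => ?_
    obtain ⟨W, hWs, hW, h0⟩ := mem_nhds_iff.1 hs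
    have hm := hx.1.preimage_mem_nhds
      ((isOpen_image_val hA hW).mem_nhds (Set.mem_image_of_mem Subtype.val h0))
    refine mem_map.2 (mem_of_superset hm fun t ht => hWs ?_)
    exact Subtype.val_injective.mem_set_image.1 ht
  · obtain ⟨c', hc', he⟩ := hc.exists_of_sub hA
    obtain ⟨k, hk⟩ := hx.2 _ K c' hc' (Set.mem_image_of_mem Subtype.val h0)
    exact ⟨k, by simpa only [Function.comp_apply, he] using hk⟩

/-- A point of the extension whose standard part lies in an open set `A` has a representative
with values in `A`. -/
theorem IsNilpotentPath.exists_lift {A : Set S} (hA : IsOpen[X.topology] A) {x : ℝ → S}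
    (hx : X.IsNilpotentPath x) (h0 : x 0 ∈ A) :
    ∃ y : ℝ → A, (X.sub A).IsNilpotentPath y ∧ x =ᶠ[𝓝 0] Subtype.val ∘ y := by
  classical
  -- The default value `x 0` is taken only away from a neighbourhood of 0, since `x` is continuous
  -- at 0; only the germ of a path matters.
  let y : ℝ → A := fun t => if h : x t ∈ A then ⟨x t, h⟩ else ⟨x 0, h0⟩
  have hxA : ∀ᶠ t in 𝓝 0, x t ∈ A := by
    let := X.topology
    exact hx.1.preimage_mem_nhds (hA.mem_nhds h0)
  have hy : x =ᶠ[𝓝 0] Subtype.val ∘ y := by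
    filter_upwards [hxA] with t ht
    simp [y, ht]
  exact ⟨y, .of_val hA (hx.congr hy), hy⟩

/-- Reduces membership in `·A` to the standard part; this is what makes `D` indiscrete and makes
`f(h) ∈ ·U` independent of `h`. -/
theorem Ext.mk_mem_dot {A : Set S} (hA : IsOpen[X.topology] A) {x : ℝ → S}
    (hx : X.IsNilpotentPath x) : Ext.mk X x hx ∈ X.dot A ↔ x 0 ∈ A := by
  constructor
  · rintro ⟨u, hu⟩
    obtain ⟨y, hy, rfl⟩ := Ext.exists_rep u
    have h : X.PathEquiv (Subtype.val ∘ y) x := Ext.mk_eq_mk.1 hu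
    -- every open set carries a constant observable
    have h' := h A ⟨0, Set.univ, isOpen_univ⟩ (fun _ => ⟨0, trivial⟩)
      ⟨hA, fun H _ _ => (bar n ⟨0, Set.univ, isOpen_univ⟩).const_mem H ⟨0, trivial⟩⟩
    exact h'.1.1 (y 0).2
  · intro h0
    obtain ⟨y, hy, hxy⟩ := hx.exists_lift hA h0
    exact ⟨Ext.mk _ y hy, Ext.mk_eq_mk.2 (.of_eventuallyEq hxy.symm)⟩

/-- The extension of a map on an open set is computed on representatives. -/
theorem Ext.exists_mapOn_eq_mk {A : Set S} (hA : IsOpen[X.topology] A) (f : A → S')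
    (hf : (X.sub A).IsArrow Y f) {x : ℝ → S} (hx : X.IsNilpotentPath x)
    (h : Ext.mk X x hx ∈ X.dot A) :
    ∃ (y : ℝ → S') (hy : Y.IsNilpotentPath y), Ext.mapOn f hf ⟨Ext.mk X x hx, h⟩ = Ext.mk Y y hy ∧
      ∀ᶠ t in 𝓝 0, ∃ ht : x t ∈ A, y t = f ⟨x t, ht⟩ := by
  obtain ⟨y, hy, hxy⟩ := hx.exists_lift hA ((Ext.mk_mem_dot hA hx).1 h)
  refine ⟨f ∘ y, hf.isNilpotentPath hy, ?_, ?_⟩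
  · have e : Ext.mk X x hx = Ext.map Subtype.val (X.isArrow_val A) (Ext.mk _ y hy) :=
      Ext.mk_eq_mk.2 (.of_eventuallyEq hxy)
    -- `Ext.mapOn` evaluates at a lift picked by choice; lifts to an open subspace are unique, so
    -- `y` may be used.
    have := Ext.mapOn_map hA f hf (Ext.mk _ y hy)
    simp only [e]
    exact this
  · filter_upwards [hxy] with t ht
    have ht' : x t = y t := ht
    exact ⟨ht' ▸ (y t).2, congrArg f (Subtype.ext ht'.symm)⟩

/-- The preimage of an open set under a figure, as a subset of the ambient Euclidean space. -/
theorem isOpen_figure_preimage {H : OpenDomain} {h : H → S} (hh : h ∈ X.fig H) {A : Set S}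
    (hA : IsOpen[X.topology] A) : IsOpen (Subtype.val '' (h ⁻¹' A) : Set (Euc H.dim)) :=
  H.isOpen.isOpenMap_subtype_val _ (hA H h hh)

/-- An arrow on an open set to a normed space, composed with a figure, is locally given by a
`Cⁿ` map. -/
theorem exists_contDiffAt_of_figure {F : Type*} [NormedAddCommGroup F] [NormedSpace ℝ F]
    {A : Set S} (hA : IsOpen[X.topology] A) {f : A → F} (hf : (X.sub A).IsArrow (std n F) f)
    {H : OpenDomain} {h : H → S} (hh : h ∈ X.fig H) (v₀ : H) (h0 : h v₀ ∈ A) :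
    ∃ ψ : Euc H.dim → F, ContDiffAt ℝ n ψ v₀ ∧
      ∀ (v : H) (hv : h v ∈ A), ψ v = f ⟨h v, hv⟩ := by
  let W : Set (Euc H.dim) := Subtype.val '' (h ⁻¹' A)
  have hW : IsOpen W := isOpen_figure_preimage hh hA
  have hWH : W ⊆ H.carrier := by rintro _ ⟨y, -, rfl⟩; exact y.2
  let J := H.restrict W hW
  let i : J → H := fun v => ⟨v.1, hWH v.2⟩
  have hi : J.Hom n H i := (contDiffOn_id (n := n)).congr fun x hx => zeroExt_of_mem _ hx
  have hmem : ∀ v : J, h (i v) ∈ A := by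
    rintro ⟨_, y, hy, rfl⟩; exact hy
  have hc : IsCn n J (f ∘ fun v => (⟨h (i v), hmem v⟩ : A)) := hf J _ (X.comp_mem hi hh)
  refine ⟨zeroExt (A := W) (f ∘ fun v : J => (⟨h (i v), hmem v⟩ : A)), ?_, fun v hv => ?_⟩
  · exact ContDiffOn.contDiffAt (s := W) hc (hW.mem_nhds ⟨v₀, h0, rfl⟩)
  · exact zeroExt_of_mem (A := W) (f ∘ fun v : J => (⟨h (i v), hmem v⟩ : A)) ⟨v, hv, rfl⟩

end General

/-! ### First order infinitesimals and affine maps in normed spaces -/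

theorem eq_zero_of_isBigO_id {E : Type*} [NormedAddCommGroup E] {x : ℝ → E}
    (hx : x =O[𝓝 0] fun t : ℝ => t) : x 0 = 0 := by
  -- The filter `𝓝 0` is not punctured, so the bound holds at `t = 0` itself.
  simpa using hx.eq_zero_imp.self_of_nhds

section Normed

variable {n : ℕ∞} [Fact (1 ≤ n)] {E F : Type*}
  [NormedAddCommGroup E] [NormedSpace ℝ E] [FiniteDimensional ℝ E]
  [NormedAddCommGroup F] [NormedSpace ℝ F] [FiniteDimensional ℝ F]

theorem Ext.exists_add_smul_const {a : ℝ → E} {x : ℝ → ℝ} (ha : (std n E).IsNilpotentPath a)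
    (hx : (std n ℝ).IsNilpotentPath x) (b : E) :
    ∃ h : (std n E).IsNilpotentPath fun t => a t + x t • b,
      Ext.mk _ a ha + Ext.mk _ x hx • Ext.const (std n E) b =
        Ext.mk (std n E) (fun t => a t + x t • b) h :=
  ⟨(isArrow_of_contDiff contDiff_add).isNilpotentPath (isNilpotentPath_pair ha
    ((isArrow_of_contDiff contDiff_smul).isNilpotentPath
      (isNilpotentPath_pair hx ((std n E).isNilpotentPath_const b)))), rfl⟩

theorem isNilpotentPath_of_isBigO {x : ℝ → E} (hx : x =O[𝓝 0] fun t : ℝ => t) :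
    (std n E).IsNilpotentPath x := by
  have h0 : x 0 = 0 := eq_zero_of_isBigO_id hx
  -- Exponent 2 suffices: `O(t)² = O(t²) = o(t)`.
  refine isNilpotentPath_std.2 ⟨2, ?_⟩
  simp only [h0, sub_zero]
  refine (hx.norm_left.pow 2).trans_isLittleO ?_
  exact isLittleO_pow_id one_lt_two

/-- The infinitesimal 0 determines `a`. The class of `t ↦ t` then gives `t • (b - b') = o(t)`, which
forces the standard vectors `b` and `b'` to be equal. -/
theorem Ext.affine_injective {a a' : (std n E).Ext} {b b' : E}
    (h : ∀ z ∈ infinitesimals n,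
      a + z • Ext.const (std n E) b = a' + z • Ext.const (std n E) b') : a = a' ∧ b = b' := by
  obtain ⟨α, hα, rfl⟩ := Ext.exists_rep a
  obtain ⟨α', hα', rfl⟩ := Ext.exists_rep a'
  have key : ∀ (x : ℝ → ℝ), x =O[𝓝 0] (fun t : ℝ => t) →
      (fun t => (α t + x t • b) - (α' t + x t • b')) =o[𝓝 0] (fun t : ℝ => t) := by
    intro x hx
    have hxn : (std n ℝ).IsNilpotentPath x := isNilpotentPath_of_isBigO hx
    obtain ⟨h1, e1⟩ := Ext.exists_add_smul_const hα hxn b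
    obtain ⟨h2, e2⟩ := Ext.exists_add_smul_const hα' hxn b'
    have := h _ ⟨x, hxn, rfl, hx⟩
    rw [e1, e2] at this
    exact (pathEquiv_std h1 h2).1 (Ext.mk_eq_mk.1 this)
  have k0 : (fun t => α t - α' t) =o[𝓝 0] (fun t : ℝ => t) := by
    simpa using key (fun _ => 0) (isBigO_zero _ _)
  refine ⟨Ext.mk_eq_mk.2 ((pathEquiv_std hα hα').2 k0), ?_⟩
  have k1 : (fun t : ℝ => t • (b - b')) =o[𝓝 0] (fun t : ℝ => t) := by
    refine ((key (fun t => t) (isBigO_refl _ _)).sub k0).congr_left fun t => ?_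
    rw [smul_sub]; abel
  by_contra hb
  have hb' : 0 < ‖b - b'‖ := norm_pos_iff.2 (sub_ne_zero.2 hb)
  -- Passing to the punctured neighbourhood provides some `t ≠ 0` with `‖t‖ * ‖b - b'‖ ≤ ‖b - b'‖ /
  -- 2 * ‖t‖`, which is absurd.
  have k2 := (k1.bound (half_pos hb')).filter_mono (nhdsWithin_le_nhds (s := {0}ᶜ))
  obtain ⟨t, ht, ht0⟩ := (k2.and self_mem_nhdsWithin).exists
  have ht0 : 0 < ‖t‖ := norm_pos_iff.2 ht0
  rw [norm_smul] at ht
  nlinarith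

end Normed

/-! ### `D` as a type of figures: indiscreteness and the generic figure -/

section Line

variable (n : ℕ∞)

/-- The coordinate on the Euclidean line. -/
theorem contDiff_coord : ContDiff ℝ n (fun v : Euc 1 => v 0) := by fun_prop

/-- The first order infinitesimals, as a type of figures. -/
noncomputable def infinitesimalDomain : ExtDomain n where
  dim := 1
  -- Types are subsets of extensions of `Euc s`, whereas `D` lies in the extension of `ℝ`, so `D` is
  -- transported along the coordinate of `Euc 1`.
  carrier := {z | Ext.map (fun v : Euc 1 => v 0) (isArrow_of_contDiff (contDiff_coord n)) z
    ∈ infinitesimals n}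

/-- The coordinate on the domain of first order infinitesimals. -/
noncomputable def infinitesimalCoord (z : infinitesimalDomain n) : infinitesimals n :=
  ⟨Ext.map (fun v : Euc 1 => v 0) (isArrow_of_contDiff (contDiff_coord n)) z.1, z.2⟩

/-- The unit vector of the Euclidean line. -/
noncomputable def unitVec : Euc 1 := EuclideanSpace.single 0 1

variable {n} [Fact (1 ≤ n)]

/-- Surjectivity of `infinitesimalCoord` with an explicit representative of the preimage: whatever
is known of `f` composed with the coordinate holds on all of `D`. -/
theorem exists_infinitesimal_lift {x : ℝ → ℝ} (hx : x =O[𝓝 0] fun t : ℝ => t) :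
    ∃ (h1 : (std n (Euc 1)).IsNilpotentPath fun t => x t • unitVec)
      (h2 : Ext.mk _ _ h1 ∈ (infinitesimalDomain n).carrier)
      (h3 : (std n ℝ).IsNilpotentPath x) (h4 : Ext.mk _ x h3 ∈ infinitesimals n),
      infinitesimalCoord n ⟨_, h2⟩ = ⟨_, h4⟩ := by
  have h3 : (std n ℝ).IsNilpotentPath x := isNilpotentPath_of_isBigO hx
  have h4 : Ext.mk _ x h3 ∈ infinitesimals n := ⟨x, h3, rfl, hx⟩
  have h1 : (std n (Euc 1)).IsNilpotentPath fun t => x t • unitVec :=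
    (isArrow_of_contDiff (g := fun r : ℝ => r • unitVec) (by fun_prop)).isNilpotentPath h3
  have e : Ext.map (fun v : Euc 1 => v 0) (isArrow_of_contDiff (contDiff_coord n))
      (Ext.mk _ _ h1) = Ext.mk _ x h3 :=
    Ext.mk_eq_mk.2 (.of_eventuallyEq (.of_eq (by funext t; simp [unitVec])))
  exact ⟨h1, show _ ∈ infinitesimals n from e ▸ h4, h3, h4, Subtype.ext e⟩

theorem exists_rep_infinitesimalDomain (z : infinitesimalDomain n) :
    ∃ (x : ℝ → Euc 1) (hx : (std n (Euc 1)).IsNilpotentPath x),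
      z.1 = Ext.mk _ x hx ∧ x 0 = 0 := by
  obtain ⟨z, hz⟩ := z
  obtain ⟨x, hx, rfl⟩ := Ext.exists_rep z
  refine ⟨x, hx, rfl, ?_⟩
  obtain ⟨y, hy, e, hO⟩ := hz
  have hx' := (isArrow_of_contDiff (contDiff_coord n)).isNilpotentPath hx
  have h : (std n ℝ).PathEquiv ((fun v : Euc 1 => v 0) ∘ x) y := Ext.mk_eq_mk.1 e
  have h2 := eq_zero_of_isBigO_id (((pathEquiv_std hx' hy).1 h).isBigO.add hO)
  have h3 : ∀ v : Euc 1, v 0 = 0 → v = 0 := fun v hv => by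
    ext i
    rwa [Subsingleton.elim i 0]
  rw [sub_add_cancel] at h2
  exact h3 _ h2

/-- All points here have standard part 0, so a basic open set contains either all of them or none.
-/
theorem mem_dot_of_infinitesimal {V : Set (Euc 1)} (hV : IsOpen V) (z : infinitesimalDomain n) :
    z.1 ∈ (std n (Euc 1)).dot V ↔ (0 : Euc 1) ∈ V := by
  obtain ⟨x, hx, e, h0⟩ := exists_rep_infinitesimalDomain z
  have h := Ext.mk_mem_dot (isOpen_std.2 hV) hx
  rw [h0, ← e] at h
  exact h

/-- The topology of the domain of first order infinitesimals is indiscrete. -/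
theorem eq_univ_of_isOpen_infinitesimalDomain {O : Set (infinitesimalDomain n)} (hO : IsOpen O)
    {s : infinitesimalDomain n} (hs : s ∈ O) : O = Set.univ := by
  suffices h : ∀ s s', s ∈ O → s' ∈ O from Set.eq_univ_of_forall fun s' => h s s' hs
  clear hs s
  have hO' : TopologicalSpace.GenerateOpen {O | ∃ U : Set (Euc (infinitesimalDomain n).dim),
    IsOpen U ∧ O = {x : infinitesimalDomain n | x.1 ∈ (std n (Euc _)).dot U}} O := hO
  induction hO' with
  | basic O h =>
    obtain ⟨V, hV, rfl⟩ := h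
    exact fun s s' h => (mem_dot_of_infinitesimal hV s').2 ((mem_dot_of_infinitesimal hV s).1 h)
  | univ => exact fun _ _ _ => trivial
  | inter O₁ O₂ h₁ h₂ i₁ i₂ => exact fun s s' h => ⟨i₁ h₁ s s' h.1, i₂ h₂ s s' h.2⟩
  | sUnion C hC i =>
    rintro s s' ⟨O, hOC, h⟩
    exact ⟨O, hOC, i O hOC (hC O hOC) s s' h⟩

/-- This is the generic figure of `D`: an arrow out of `D` is controlled by its effect on this
figure alone. -/
theorem infinitesimalCoord_mem_figures :
    infinitesimalCoord n ∈ (std n ℝ).inducedFigures (infinitesimals n) (infinitesimalDomain n) := by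
  have hu : ∀ (E : Type) [NormedAddCommGroup E] [NormedSpace ℝ E] [FiniteDimensional ℝ E]
      (z : (std n E).Ext), z ∈ (std n E).dot Set.univ := fun E _ _ _ z => by
    obtain ⟨x, hx, rfl⟩ := Ext.exists_rep z
    exact (Ext.mk_mem_dot (isOpen_std.2 isOpen_univ) hx).2 trivial
  intro s
  refine ⟨Set.univ, infinitesimalDomain n, infinitesimalCoord n,
    fun x => ⟨x.1, by obtain ⟨_, y, -, rfl⟩ := x; exact y.2⟩, isOpen_univ, trivial,
    Or.inr ⟨Set.univ, isOpen_univ, fun v : (Set.univ : Set (Euc 1)) => v.1 0, ?_, fun z _ => hu _ z, ?_⟩, ?_,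
    fun x _ => rfl⟩
  · exact ((contDiff_coord n).contDiffOn (s := Set.univ)).congr fun v hv => zeroExt_of_mem _ hv
  · rintro ⟨z, hz⟩
    obtain ⟨x, hx, rfl⟩ := Ext.exists_rep z
    obtain ⟨y, hy, e, h⟩ := Ext.exists_mapOn_eq_mk (X := std n (Euc 1)) (Y := std n ℝ)
      (isOpen_std.2 isOpen_univ) (fun v : (Set.univ : Set (Euc 1)) => v.1 0)
      (isArrow_of_mem_fig (std n ℝ) (H := ⟨1, Set.univ, isOpen_univ⟩)
        (((contDiff_coord n).contDiffOn (s := Set.univ)).congr fun v hv => zeroExt_of_mem _ hv))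
      hx (hu _ _)
    refine Eq.trans ?_ e.symm
    refine Ext.mk_eq_mk.2 (.of_eventuallyEq ?_)
    filter_upwards [h] with t ht
    exact ht.2.symm
  · intro s
    have hg : ContDiffOn ℝ n (zeroExt (A := (Set.univ : Set (Euc 0)) ×ˢ (Set.univ : Set (Euc 1)))
        fun q => q.1.2) (Set.univ ×ˢ Set.univ) :=
      (contDiff_snd.contDiffOn).congr fun v hv => zeroExt_of_mem _ hv
    -- The inclusion needs no parameter: a dummy one in dimension 0 is discarded by the second
    -- projection.
    refine ⟨0, Ext.const _ 0, Set.univ, Set.univ, fun q => q.1.2, hg, isOpen_univ, hu _ _,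
      isOpen_univ, hu _ _, ?_⟩
    rintro ⟨z, hz⟩ -
    obtain ⟨x, hx, rfl⟩ := Ext.exists_rep z
    have hm : Ext.pair (Ext.const (std n (Euc 0)) 0) (Ext.mk (std n (Euc 1)) x hx) ∈
        (std n (Euc 0 × Euc 1)).dot (Set.univ ×ˢ Set.univ) :=
      (Ext.mk_mem_dot (isOpen_std.2 (isOpen_univ.prod isOpen_univ)) _).2 ⟨trivial, trivial⟩
    refine ⟨hm, ?_⟩
    obtain ⟨y, hy, e, h⟩ := Ext.exists_mapOn_eq_mk (X := std n (Euc 0 × Euc 1))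
      (isOpen_std.2 (isOpen_univ.prod isOpen_univ)) _ (isArrow_of_contDiffOn hg) _ hm
    refine Eq.trans ?_ e.symm
    refine Ext.mk_eq_mk.2 (.of_eventuallyEq ?_)
    filter_upwards [h] with t ht
    exact ht.2.symm

end Line

/-! ### Global form of the arrows `D → ·X` -/

section Structure

variable {n : ℕ∞} [Fact (1 ≤ n)] {S : Type*} {X : CnSpace n S}

/-- Arrows on the first order infinitesimals are globally either constant, or given by a figure of
the space composed with a `Cⁿ` map depending on an extended parameter. -/
theorem constant_or_exists_figure {f : infinitesimals n → X.Ext}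
    (hf : ExtFigures.IsArrow ((std n ℝ).inducedFigures (infinitesimals n)) X.extFigures f) :
    (∃ z, ∀ h, f h = z) ∨
    ∃ (m : ℕ) (p : ℝ → Euc m) (H : OpenDomain) (h : H → S) (G : Euc m × Euc 1 → Euc H.dim),
      Tendsto p (𝓝 0) (𝓝 (p 0)) ∧ h ∈ X.fig H ∧ ContDiffAt ℝ n G (p 0, 0) ∧
      G (p 0, 0) ∈ H.carrier ∧
      ∀ (x : ℝ → ℝ) (_ : x =O[𝓝 0] fun t : ℝ => t) (hx : (std n ℝ).IsNilpotentPath x)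
        (hx' : Ext.mk _ x hx ∈ infinitesimals n),
        ∃ (y : ℝ → S) (hy : X.IsNilpotentPath y), f ⟨_, hx'⟩ = Ext.mk X y hy ∧
          ∀ᶠ t in 𝓝 0, ∃ ht : G (p t, x t • unitVec) ∈ H.carrier, y t = h ⟨_, ht⟩ := by
  obtain ⟨z1, z2, z3, z4, z5⟩ := exists_infinitesimal_lift (n := n) (x := fun _ => 0)
    (isBigO_zero _ _)
  obtain ⟨O, T, d, e, hO, hsO, hd, he, hfe⟩ :=
    hf _ _ (infinitesimalCoord_mem_figures (n := n)) ⟨_, z2⟩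
  -- The description of the figure near the point over 0 is valid everywhere.
  obtain rfl := eq_univ_of_isOpen_infinitesimalDomain hO hsO
  rcases hd with ⟨z, rfl⟩ | ⟨V, hV, h, hh, hT, hdx⟩
  · refine Or.inl ⟨z.1, ?_⟩
    rintro ⟨w, x, hx, rfl, hxO⟩
    obtain ⟨h1, h2, h3, h4, h5⟩ := exists_infinitesimal_lift (n := n) hxO
    rw [← h5]
    exact congrArg Subtype.val (hfe ⟨_, h2⟩ trivial)
  · obtain ⟨m, p, A, B, g, hg, hA, hp, hB, hs, hgx⟩ := he ⟨_, ⟨_, z2⟩, trivial, rfl⟩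
    obtain ⟨π, hπ, rfl⟩ := Ext.exists_rep p
    have hπA := (Ext.mk_mem_dot (isOpen_std.2 hA) hπ).1 hp
    -- The same effect for the arrow of types: since `0 ∈ B`, the formula with `g` and `p` holds at
    -- every point of the domain.
    have h0B : (0 : Euc 1) ∈ B := (mem_dot_of_infinitesimal hB ⟨_, z2⟩).1 hs
    have key : ∀ (x : ℝ → ℝ) (_ : x =O[𝓝 0] fun t : ℝ => t) (hx : (std n ℝ).IsNilpotentPath x)
        (hx' : Ext.mk _ x hx ∈ infinitesimals n),
        ∃ (y : ℝ → S) (hy : X.IsNilpotentPath y), f ⟨_, hx'⟩ = Ext.mk X y hy ∧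
          ∀ᶠ t in 𝓝 0, ∃ ht : zeroExt g (π t, x t • unitVec) ∈ V, y t = h ⟨_, ht⟩ := by
      intro x hxO hx hx'
      obtain ⟨h1, h2, h3, h4, h5⟩ := exists_infinitesimal_lift (n := n) hxO
      obtain ⟨hm, hm'⟩ := hgx ⟨_, ⟨_, h2⟩, trivial, rfl⟩
        ((mem_dot_of_infinitesimal hB ⟨_, h2⟩).2 h0B)
      obtain ⟨u, hu, eu, hu'⟩ := Ext.exists_mapOn_eq_mk (isOpen_std.2 (hA.prod hB)) g
        (isArrow_of_contDiffOn hg) (isNilpotentPath_pair hπ h1) hm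
      have hV' := hT (e ⟨_, ⟨_, h2⟩, trivial, rfl⟩).2
      have e1 := hdx (e ⟨_, ⟨_, h2⟩, trivial, rfl⟩)
      have e2 : (e ⟨_, ⟨_, h2⟩, trivial, rfl⟩).1 = Ext.mk _ u hu := hm'.trans eu
      have hV2 : Ext.mk _ u hu ∈ (std n (Euc T.dim)).dot V := e2 ▸ hV'
      obtain ⟨y, hy, ey, hy'⟩ := Ext.exists_mapOn_eq_mk (isOpen_std.2 hV) h
        (X.isArrow_of_mem_fig hh) hu hV2
      refine ⟨y, hy, ?_, ?_⟩
      · have e3 := congrArg Subtype.val (hfe ⟨_, h2⟩ trivial)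
        have e4 : f (infinitesimalCoord n ⟨_, h2⟩) = Ext.mk X y hy := by
          refine e3.trans (e1.trans ?_)
          rw [← ey]
          congr 1
          exact Subtype.ext e2
        rw [h5] at e4
        exact e4
      · filter_upwards [hu', hy'] with t ⟨ht, hut⟩ ⟨ht', hyt⟩
        have : zeroExt g (π t, x t • unitVec) = u t := (zeroExt_of_mem g ht).trans hut.symm
        refine ⟨this ▸ ht', hyt.trans (congrArg h (Subtype.ext this.symm))⟩
    -- Reading the germ for the zero path at `t = 0` shows that `G (p 0, 0)` lies in the domain of
    -- the figure.
    obtain ⟨y, -, -, hy⟩ := key _ (isBigO_zero _ _) z3 z4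
    obtain ⟨h0, -⟩ := hy.self_of_nhds
    refine Or.inr ⟨m, π, ⟨T.dim, V, hV⟩, h, zeroExt g, hπ.tendsto, hh, ?_, ?_, key⟩
    · exact hg.contDiffAt ((hA.prod hB).mem_nhds ⟨hπA, h0B⟩)
    · rwa [zero_smul] at h0

end Structure

end CnSpace

/-! ### The affine formula: existence by strict differentiability, then uniqueness -/

theorem mainTheorem2 {n : ℕ∞} [Fact (1 ≤ n)] {S : Type*} (X : CnSpace n S) {k : ℕ}
    {U : Set S} (hU : IsOpen[X.topology] U)
    (φ : U → Euc k) (hφ : (X.sub U).IsArrow (std n (Euc k)) φ)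
    (f : infinitesimals n → X.Ext)
    (hf : ExtFigures.IsArrow ((std n ℝ).inducedFigures (infinitesimals n)) X.extFigures f)
    (hf0 : f ⟨Ext.const (std n ℝ) 0, zero_mem_infinitesimals n⟩ ∈ X.dot U) :
    ∃ hfU : ∀ h : infinitesimals n, f h ∈ X.dot U,
      ∃! ab : (std n (Euc k)).Ext × Euc k, ∀ h : infinitesimals n,
        Ext.mapOn φ hφ ⟨f h, hfU h⟩ = ab.1 + h.1 • Ext.const (std n (Euc k)) ab.2 := by
  suffices H : ∃ hfU : ∀ h : infinitesimals n, f h ∈ X.dot U,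
      ∃ (a : (std n (Euc k)).Ext) (b : Euc k), ∀ h : infinitesimals n,
        Ext.mapOn φ hφ ⟨f h, hfU h⟩ = a + h.1 • Ext.const (std n (Euc k)) b by
    obtain ⟨hfU, a, b, hab⟩ := H
    refine ⟨hfU, (a, b), hab, fun ab h => ?_⟩
    obtain ⟨h1, h2⟩ := Ext.affine_injective fun z hz => (h ⟨z, hz⟩).symm.trans (hab ⟨z, hz⟩)
    exact Prod.ext h1 h2
  rcases constant_or_exists_figure hf with ⟨z, hz⟩ | ⟨m, p, H, h, G, hp, hh, hG, hGH, hfy⟩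
  · have hzU : z ∈ X.dot U := hz _ ▸ hf0
    refine ⟨fun h => hz h ▸ hzU, Ext.mapOn φ hφ ⟨z, hzU⟩, 0, ?_⟩
    rintro ⟨w, x, hx, rfl, hxO⟩
    have e : Ext.mapOn φ hφ ⟨f ⟨_, x, hx, rfl, hxO⟩, hz _ ▸ hzU⟩ = Ext.mapOn φ hφ ⟨z, hzU⟩ := by
      congr 1
      exact Subtype.ext (hz _)
    rw [e]
    obtain ⟨α, hα, eα⟩ := Ext.exists_rep (Ext.mapOn φ hφ ⟨z, hzU⟩)
    obtain ⟨h1, e1⟩ := Ext.exists_add_smul_const hα hx (0 : Euc k)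
    rw [eα, e1]
    exact Ext.mk_eq_mk.2 (.of_eventuallyEq (.of_eq (by simp)))
  · have h0U : h ⟨_, hGH⟩ ∈ U := by
      obtain ⟨y, hy, e, hy'⟩ := hfy (fun _ => 0) (isBigO_zero _ _)
        ((std n ℝ).isNilpotentPath_const 0) (zero_mem_infinitesimals n)
      have e' : f ⟨Ext.const (std n ℝ) 0, zero_mem_infinitesimals n⟩ = Ext.mk X y hy := e
      rw [e', Ext.mk_mem_dot hU] at hf0
      obtain ⟨ht, e0⟩ := hy'.self_of_nhds
      rw [e0] at hf0
      simpa using hf0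
    obtain ⟨ψ, hψ, hψφ⟩ := exists_contDiffAt_of_figure hU hφ hh ⟨_, hGH⟩ h0U
    let Ψ : Euc m × Euc 1 → Euc k := fun q => ψ (G q)
    have hΨ : ContDiffAt ℝ n Ψ (p 0, 0) := ContDiffAt.comp (p 0, (0 : Euc 1)) hψ hG
    -- the composition with `φ`, on representatives
    have key : ∀ (x : ℝ → ℝ) (_ : x =O[𝓝 0] fun t : ℝ => t) (hx : (std n ℝ).IsNilpotentPath x)
        (hx' : Ext.mk _ x hx ∈ infinitesimals n),
        ∃ hm : f ⟨_, hx'⟩ ∈ X.dot U, ∃ (w : ℝ → Euc k) (hw : (std n (Euc k)).IsNilpotentPath w),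
          Ext.mapOn φ hφ ⟨f ⟨_, hx'⟩, hm⟩ = Ext.mk _ w hw ∧
          w =ᶠ[𝓝 0] fun t => Ψ (p t, x t • unitVec) := by
      intro x hxO hx hx'
      obtain ⟨y, hy, e, hy'⟩ := hfy x hxO hx hx'
      have hm : Ext.mk X y hy ∈ X.dot U := by
        rw [Ext.mk_mem_dot hU]
        -- As `x 0 = 0`, the standard part `y 0` is `h (G (p 0, 0))` whatever `x` is, and this point
        -- lies in `U`.
        obtain ⟨ht, e0⟩ := hy'.self_of_nhds
        rw [e0]
        simpa [eq_zero_of_isBigO_id hxO] using h0U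
      obtain ⟨w, hw, ew, hw'⟩ := Ext.exists_mapOn_eq_mk hU φ hφ hy hm
      refine ⟨e ▸ hm, w, hw, ?_, ?_⟩
      · rw [← ew]
        congr 1
        exact Subtype.ext e
      · filter_upwards [hy', hw'] with t ⟨ht, hyt⟩ ⟨ht', hwt⟩
        rw [hwt]
        refine Eq.trans (congrArg φ (Subtype.ext hyt)) (hψφ ⟨_, ht⟩ (hyt ▸ ht')).symm
    have hfU : ∀ h : infinitesimals n, f h ∈ X.dot U := by
      rintro ⟨w, x, hx, rfl, hxO⟩
      exact (key x hxO hx _).1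
    -- `a` is the value at the infinitesimal 0; its representative is `Ψ (p t, 0)` near 0, in
    -- general not a standard point.
    obtain ⟨hm, α, hα, eα, hα'⟩ := key (fun _ => 0) (isBigO_zero _ _)
      ((std n ℝ).isNilpotentPath_const 0) (zero_mem_infinitesimals n)
    have hn1 : (n : WithTop ℕ∞) ≠ 0 := by
      have : (1 : ℕ∞) ≤ n := Fact.out
      rintro h0
      have : n = 0 := by exact_mod_cast h0
      simp_all
    -- Strict differentiability compares two moving points, here `(p t, x t • unitVec)` and `(p t,
    -- 0)`, with the derivative at the fixed point `(p 0, 0)`.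
    have hstrict := (hΨ.hasStrictFDerivAt hn1).isLittleO
    set L := fderiv ℝ Ψ (p 0, 0)
    refine ⟨hfU, Ext.mk _ α hα, L (0, unitVec), ?_⟩
    rintro ⟨_, x, hx, rfl, hxO⟩
    obtain ⟨hm, w, hw, ew, hw'⟩ := key x hxO hx ⟨x, hx, rfl, hxO⟩
    obtain ⟨h1, e1⟩ := Ext.exists_add_smul_const hα hx (L (0, unitVec))
    refine ew.trans (Eq.trans ?_ e1.symm)
    refine Ext.mk_eq_mk.2 ((pathEquiv_std hw h1).2 ?_)
    have hx0 : Tendsto (fun t => x t • unitVec) (𝓝 0) (𝓝 0) := by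
      have := (hx.tendsto).smul_const unitVec
      simpa [eq_zero_of_isBigO_id hxO] using this
    have ht : Tendsto (fun t => ((p t, x t • unitVec), (p t, (0 : Euc 1)))) (𝓝 0)
        (𝓝 ((p 0, 0), (p 0, 0))) :=
      (hp.prodMk_nhds hx0).prodMk_nhds (hp.prodMk_nhds tendsto_const_nhds)
    -- The parameter cancels in the increment, so nothing is needed about the rate at which `p t`
    -- tends to `p 0`.
    have hO : (fun t => ((p t, x t • unitVec) : Euc m × Euc 1) - (p t, 0)) =O[𝓝 0]
        (fun t : ℝ => t) := by
      refine IsBigO.trans (IsBigO.of_bound ‖unitVec‖ (Eventually.of_forall fun t => ?_)) hxO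
      simp [norm_smul, mul_comm, mul_nonneg]
    refine ((hstrict.comp_tendsto ht).trans_isBigO hO).congr' ?_ EventuallyEq.rfl
    filter_upwards [hw', hα'] with t h1 h2
    rw [h1, h2]
    have : ((p t, x t • unitVec) : Euc m × Euc 1) - (p t, 0) = x t • (0, unitVec) := by simp
    simp only [Function.comp_apply, this, map_smul, zero_smul]
    abel
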